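/- Let $G$ be a finitely generated group. For a finite generating set $A$ of $G$ let $\tilde A=A\cup A^{-1}$ (with formal inverse letters) and let $\pi:\tilde A^*\to G$ be the canonical homomorphism. A subset $K\subseteq G$ is called rational (resp. algebraic) if $K=L\pi$ for some rational, i.e. regular (resp. context-free), language $L\subseteq\tilde A^*$; this does not depend on the choice of $A$. Let $\mathrm{Rat}(G)$ and $\mathrm{Alg}(G)$ be the classes of rational and algebraic subsets of $G$. For $\varphi\in\mathrm{Aut}(G)$ put $\mathrm{Orb}_\varphi(g)=\{g\varphi^k\mid k\ge 0\}$ and let $G\rtimes_\varphi\mathbb Z=\langle G,t\mid t^{-1}gt=g\varphi\ (g\in G)\rangle$, which contains $G$ as a subgroup. Let $Q=\begin{bmatrix}2&1\\1&1\end{bmatrix}\in GL_2(\mathbb Z)$, acting on row vectors of $\mathbb Z^2$ by $v\mapsto vQ$, and let $(f_n)_{n\ge 0}$ be the Fibonacci sequence, $f_0=0$, $f_1=1$. Then: 1. $Q^k=\begin{bmatrix}f_{2k+1}&f_{2k}\\f_{2k}&f_{2k-1}\end{bmatrix}$ for all $k\ge 1$, and $\mathrm{Orb}_Q((1,0))$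 is the set of first rows of the powers $Q^k$, $k\ge 0$, that is, $\mathrm{Orb}_Q((1,0))=\{(f_{2k+1},f_{2k})\mid k\ge 0\}$. 2. $\mathrm{Alg}(\mathbb Z^2)=\mathrm{Rat}(\mathbb Z^2)$, and $\mathrm{Orb}_Q((1,0))$ is not a rational subset, equivalently not an algebraic subset, of $\mathbb Z^2$. 3. $\mathrm{Alg}(\mathbb Z^2)\neq\{K\subseteq\mathbb Z^2\mid K\in\mathrm{Alg}(\mathbb Z^2\rtimes_Q\mathbb Z)\}$. 4. Consequently Herbst's question has a negative answer: it is not true that $\mathrm{Alg}(H)=\{K\subseteq H\mid K\in\mathrm{Alg}(G)\}$ for every finitely generated group $G$ and every finitely generated subgroup $H\le G$. -/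

import Mathlib

open Matrix

namespace HerbstFatou

universe u

section Subsets

variable {G : Type u} [Group G]

/-- Words over `Ã = A ∪ A⁻¹` are lists over `A × Bool`, where `(a, true)` is the letter `a` and
`(a, false)` is the formal inverse letter `a⁻¹`. This is the canonical homomorphism `π : Ã* → G`. -/
def wordValue (A : Finset G) (w : List (A × Bool)) : G :=
  (w.map fun x => if x.2 then (x.1 : G) else (x.1 : G)⁻¹).prod

/-- `K` is the image under `π : Ã* → G` of a rational (i.e. regular) language,
for some finite generating set `A` of `G`. -/
def IsRationalSubset (K : Set G) : Prop :=
  ∃ A : Finset G, Subgroup.closure (A : Set G) = ⊤ ∧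
    ∃ L : Language (A × Bool), L.IsRegular ∧ wordValue A '' {w | w ∈ L} = K

/-- `K` is the image under `π : Ã* → G` of a context-free language,
for some finite generating set `A` of `G`. -/
def IsAlgebraicSubset (K : Set G) : Prop :=
  ∃ A : Finset G, Subgroup.closure (A : Set G) = ⊤ ∧
    ∃ L : Language (A × Bool), L.IsContextFree ∧ wordValue A '' {w | w ∈ L} = K

/-- The orbit `{g φᵏ | k ∈ ℕ}` of `g` through an automorphism `φ`. -/
def autOrbit (φ : MulAut G) (g : G) : Set G :=
  {x | ∃ k : ℕ, x = (φ ^ k) g}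

/-- The action of `ℤ` used for `G ⋊_φ ℤ`. The generator `t` of `ℤ` acts by `φ⁻¹`, so that
`t⁻¹ g t = φ g`, see `conj_eq`. -/
def zAction (φ : MulAut G) : Multiplicative ℤ →* MulAut G :=
  zpowersHom (MulAut G) φ⁻¹

end Subsets

/-- The class `Rat(G)` of rational subsets of `G`. -/
def Rat (G : Type u) [Group G] : Set (Set G) := {K | IsRationalSubset K}

/-- The class `Alg(G)` of algebraic subsets of `G`. -/
def Alg (G : Type u) [Group G] : Set (Set G) := {K | IsAlgebraicSubset K}

/-- The semidirect product `G ⋊_φ ℤ = ⟨G, t | t⁻¹ g t = φ g⟩`. -/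
abbrev ZExtension (G : Type u) [Group G] (φ : MulAut G) : Type u :=
  G ⋊[zAction φ] (Multiplicative ℤ)

/-- The stable letter `t` of `G ⋊_φ ℤ` satisfies `t⁻¹ g t = φ g`. -/
theorem conj_eq {G : Type u} [Group G] (φ : MulAut G) (g : G) :
    (SemidirectProduct.inr (Multiplicative.ofAdd 1) : ZExtension G φ)⁻¹ *
      SemidirectProduct.inl g * SemidirectProduct.inr (Multiplicative.ofAdd 1) =
      SemidirectProduct.inl (φ g) := by
  have h : zAction φ (Multiplicative.ofAdd (1 : ℤ))⁻¹ = φ := by simp [zAction]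
  rw [← map_inv, ← SemidirectProduct.inl_aut_inv, ← map_inv, h]

/-- The group `ℤ²`, written multiplicatively. -/
abbrev Z2 : Type := Multiplicative (Fin 2 → ℤ)

/-- The automorphism `v ↦ v M` of `ℤ²` (acting on row vectors) given by `M ∈ GL₂(ℤ)`. -/
def rowAut (M : GL (Fin 2) ℤ) : MulAut Z2 where
  toFun v := Multiplicative.ofAdd (v.toAdd ᵥ* (M : Matrix (Fin 2) (Fin 2) ℤ))
  invFun v := Multiplicative.ofAdd (v.toAdd ᵥ* ((M⁻¹ : GL (Fin 2) ℤ) : Matrix (Fin 2) (Fin 2) ℤ))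
  left_inv v := by
    simp only [toAdd_ofAdd]
    rw [Matrix.vecMul_vecMul, Units.mul_inv, Matrix.vecMul_one, ofAdd_toAdd]
  right_inv v := by
    simp only [toAdd_ofAdd]
    rw [Matrix.vecMul_vecMul, Units.inv_mul, Matrix.vecMul_one, ofAdd_toAdd]
  map_mul' v w := by
    rw [toAdd_mul, Matrix.add_vecMul, ofAdd_add]

/-- The matrix `Q = [[2, 1], [1, 1]] ∈ GL₂(ℤ)`. -/
def Q : GL (Fin 2) ℤ where
  val := !![2, 1; 1, 1]
  inv := !![1, -1; -1, 2]
  val_inv := by decide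
  inv_val := by decide

end HerbstFatou

/-! In $G\rtimes_\varphi\mathbb Z$ the orbit of $g$ is the set of all $t^{-k}gt^k$, the image of the
language with grammar $S\to t^{-1}St\mid g$; so every orbit is algebraic there
(`isAlgebraicSubset_inl_autOrbit`).

In a commutative group the value of a word depends only on its multiset of letters. By Parikh's
theorem (`isSemilinearSet_parikhImage`) algebraic subsets have semilinear images there, and an
infinite semilinear set contains an infinite arithmetic progression. The first coordinates
$f_{2k+1}$ of the orbit have growing gaps, so they contain none. Conversely every semilinear set of
multisets comes from a regular language, which gives $\mathrm{Alg}=\mathrm{Rat}$.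

Parikh's theorem is proved with commutative grammars, by induction on the set of symbols that may be
rewritten. Allowing one more symbol $X$ reduces to a balance equation between the occurrences of $X$
consumed and those supplied (`commDerives_insert_iff`), and the solutions of that equation are
semilinear (`isSemilinearSet_balance`). -/

namespace HerbstFatou

/-! ### Commutative grammars and semilinearity of their reachability sets. -/

section CommutativeGrammar

variable {σ : Type*}

/-- One step of a commutative grammar with rules `R`, rewriting only symbols in `V`. -/
def CommStep (R : Set (σ × Multiset σ)) (V : Set σ) (c d : Multiset σ) : Prop :=
  ∃ a ∈ V, ∃ r, (a, r) ∈ R ∧ ∃ e, c = {a} + e ∧ d = r + e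

/-- Derivability in a commutative grammar, rewriting only symbols in `V`. -/
def CommDerives (R : Set (σ × Multiset σ)) (V : Set σ) : Multiset σ → Multiset σ → Prop :=
  Relation.ReflTransGen (CommStep R V)

variable {R : Set (σ × Multiset σ)} {V W : Set σ} {c d : Multiset σ} {X : σ}

theorem CommStep.add_right (h : CommStep R V c d) (e : Multiset σ) :
    CommStep R V (c + e) (d + e) := by
  obtain ⟨a, ha, r, hr, f, rfl, rfl⟩ := h
  exact ⟨a, ha, r, hr, f + e, by rw [add_assoc], by rw [add_assoc]⟩

theorem CommDerives.add_right (h : CommDerives R V c d) (e : Multiset σ) :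
    CommDerives R V (c + e) (d + e) :=
  Relation.ReflTransGen.lift (· + e) (fun _ _ h => h.add_right e) _ _ h

theorem CommDerives.mono (hVW : V ⊆ W) (h : CommDerives R V c d) : CommDerives R W c d :=
  Relation.ReflTransGen.mono
    (fun _ _ ⟨a, ha, r, hr, e, h₁, h₂⟩ => ⟨a, hVW ha, r, hr, e, h₁, h₂⟩) _ _ h

/-- If a configuration contains `X`, then every multiset of replacements of `X` that satisfies the
balance equation can be carried out in some order. -/
theorem commDerives_of_balance (ts : Multiset (Multiset σ))
    (hts : ∀ t ∈ ts, CommDerives R V {X} t) (hX : X ∈ c ∨ ts = 0)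
    (h : d + Multiset.card ts • {X} = c + ts.sum) : CommDerives R V c d := by
  classical
  induction hn : Multiset.card ts generalizing c ts with
  | zero =>
    obtain rfl := Multiset.card_eq_zero.1 hn
    simp at h
    exact h ▸ Relation.ReflTransGen.refl
  | succ n ih =>
    have hXc : X ∈ c := hX.resolve_right (by rintro rfl; simp at hn)
    obtain ⟨c', rfl⟩ := Multiset.exists_cons_of_mem hXc
    have key : ∀ t ts', ts = t ::ₘ ts' → (X ∈ t + c' ∨ ts' = 0) → CommDerives R V (X ::ₘ c') d := by
      rintro t ts' rfl hX'
      refine Relation.ReflTransGen.trans (b := t + c') ?_ ?_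
      · rw [← Multiset.singleton_add]
        exact (hts t (by simp)).add_right c'
      · refine ih ts' (fun u hu => hts u (by simp [hu])) hX' ?_ (by simpa using hn)
        rw [Multiset.card_cons, Multiset.sum_cons, succ_nsmul, ← Multiset.singleton_add] at h
        have : {X} + (d + Multiset.card ts' • {X}) = {X} + (t + c' + ts'.sum) := by
          calc _ = d + (Multiset.card ts' • {X} + {X}) := by abel
            _ = _ := by rw [h]; abel
        exact add_left_cancel this
    -- A replacement that reproduces `X` goes first, so `X` stays available. If none does, counting
    -- `X` in the balance equation shows that `c` already holds enough copies.
    by_cases hex : ∃ t ∈ ts, X ∈ t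
    · obtain ⟨t, ht, hXt⟩ := hex
      obtain ⟨ts', rfl⟩ := Multiset.exists_cons_of_mem ht
      exact key t ts' rfl (Or.inl (by simp [hXt]))
    · push Not at hex
      obtain ⟨t, ht⟩ := Multiset.card_pos_iff_exists_mem.1 (by lia : 0 < Multiset.card ts)
      obtain ⟨ts', rfl⟩ := Multiset.exists_cons_of_mem ht
      refine key t ts' rfl ?_
      by_cases hts' : ts' = 0
      · exact Or.inr hts'
      · left
        have hsum : X ∉ (t ::ₘ ts').sum := by
          intro hmem
          obtain ⟨u, hu, hXu⟩ := Multiset.mem_join.1 hmem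
          exact hex u hu hXu
        have hcount := congrArg (Multiset.count X) h
        rw [Multiset.count_add, Multiset.count_add, Multiset.count_eq_zero_of_notMem hsum,
          Multiset.count_nsmul, Multiset.count_singleton_self, Multiset.count_cons_self,
          Multiset.card_cons] at hcount
        have := Multiset.card_pos.2 hts'
        have : 0 < Multiset.count X c' := by lia
        exact Multiset.mem_add.2 (Or.inr (Multiset.count_pos.1 this))

/-- The configurations derivable from some right-hand side of a rule for `X`. -/
def replacements (R : Set (σ × Multiset σ)) (V : Set σ) (X : σ) : Set (Multiset σ) :=
  {t | ∃ r, (X, r) ∈ R ∧ CommDerives R V r t}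

/-- Derivations using one more symbol `X` in terms of derivations not rewriting `X`. -/
theorem commDerives_insert_iff (hX : X ∉ V) :
    CommDerives R (insert X V) c d ↔ CommDerives R V c d ∨
      ∃ c₀, CommDerives R V c c₀ ∧ X ∈ c₀ ∧ ∃ ts : Multiset (Multiset σ),
        (∀ t ∈ ts, t ∈ replacements R V X) ∧ d + Multiset.card ts • {X} = c₀ + ts.sum := by
  classical
  constructor
  · intro h
    induction h with
    | refl => exact Or.inl Relation.ReflTransGen.refl
    | tail _ hstep ih =>
      obtain ⟨a, ha, r, hr, e, rfl, rfl⟩ := hstep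
      rcases Set.mem_insert_iff.1 ha with rfl | haV
      · right
        rcases ih with ih | ⟨c₀, hc₀, hXc₀, ts, hts, heq⟩
        · exact ⟨_, ih, by simp, {r}, by
            simpa using ⟨r, hr, Relation.ReflTransGen.refl⟩, by
            rw [Multiset.card_singleton, one_smul, Multiset.sum_singleton]; abel⟩
        · refine ⟨c₀, hc₀, hXc₀, r ::ₘ ts, ?_, ?_⟩
          · simp only [Multiset.mem_cons, forall_eq_or_imp]
            exact ⟨⟨r, hr, Relation.ReflTransGen.refl⟩, hts⟩
          · rw [Multiset.card_cons, Multiset.sum_cons, succ_nsmul]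
            calc _ = r + ({a} + e + Multiset.card ts • {a}) := by abel
              _ = _ := by rw [heq]; abel
      · rcases ih with ih | ⟨c₀, hc₀, hXc₀, ts, hts, heq⟩
        · exact Or.inl (ih.tail ⟨a, haV, r, hr, e, rfl, rfl⟩)
        · right
          have haX : a ≠ X := by rintro rfl; exact hX haV
          have hmem : a ∈ c₀ + ts.sum := by rw [← heq]; simp
          rcases Multiset.mem_add.1 hmem with hac | hat
          · obtain ⟨c₁, rfl⟩ := Multiset.exists_cons_of_mem hac
            rw [← Multiset.singleton_add] at *
            refine ⟨r + c₁, hc₀.tail ⟨a, haV, r, hr, c₁, rfl, rfl⟩, ?_, ts, hts, ?_⟩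
            · have : X ∈ c₁ := by simpa [haX.symm] using hXc₀
              simp [this]
            · have : e + Multiset.card ts • {X} = c₁ + ts.sum := by
                apply add_left_cancel (a := {a})
                rw [← add_assoc, heq, add_assoc]
              rw [add_assoc, this, add_assoc]
          · obtain ⟨t, ht, hat'⟩ := Multiset.mem_join.1 hat
            obtain ⟨ts', rfl⟩ := Multiset.exists_cons_of_mem ht
            obtain ⟨t', rfl⟩ := Multiset.exists_cons_of_mem hat'
            rw [← Multiset.singleton_add a] at *
            refine ⟨c₀, hc₀, hXc₀, (r + t') ::ₘ ts', ?_, ?_⟩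
            · simp only [Multiset.mem_cons, forall_eq_or_imp] at hts ⊢
              obtain ⟨⟨r₀, hr₀, hder⟩, hts'⟩ := hts
              exact ⟨⟨r₀, hr₀, hder.tail ⟨a, haV, r, hr, t', rfl, rfl⟩⟩, hts'⟩
            · simp only [Multiset.card_cons, Multiset.sum_cons] at heq ⊢
              have : e + (Multiset.card ts' + 1) • {X} = c₀ + (t' + ts'.sum) := by
                apply add_left_cancel (a := {a})
                rw [← add_assoc, heq]; abel
              rw [add_assoc, this]; abel
  · rintro (h | ⟨c₀, hc₀, hXc₀, ts, hts, heq⟩)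
    · exact h.mono (Set.subset_insert X V)
    · refine (hc₀.mono (Set.subset_insert X V)).trans
        (commDerives_of_balance ts (fun t ht => ?_) (Or.inl hXc₀) heq)
      obtain ⟨r, hr, hder⟩ := hts t ht
      exact Relation.ReflTransGen.head
        ⟨X, Set.mem_insert X V, r, hr, 0, by simp, by simp⟩ (hder.mono (Set.subset_insert X V))

theorem addMonoidFG_multiset [Finite σ] : AddMonoid.FG (Multiset σ) := by
  refine ⟨(AddSubmonoid.fg_iff _).2 ⟨Set.range fun a : σ => ({a} : Multiset σ), ?_,
    Set.finite_range _⟩⟩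
  refine eq_top_iff.2 fun m _ => ?_
  induction m using Multiset.induction with
  | empty => exact zero_mem _
  | cons a m ih =>
    rw [← Multiset.singleton_add]
    exact add_mem (AddSubmonoid.subset_closure ⟨a, rfl⟩) (ih trivial)

open Pointwise in
-- Recording the number of replacements in an extra coordinate makes the condition linear: the pairs
-- `(c₀ + ts.sum, card ts)` form the sum of `L × {0}` (cut down to `X ∈ c₀`) and the submonoid
-- generated by `T × {1}`. Pulling back along `(d, n) ↦ (d + n • {X}, n)` and projecting to `d`
-- preserves semilinearity.
theorem isSemilinearSet_balance [Finite σ] (X : σ) {L T : Set (Multiset σ)}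
    (hL : IsSemilinearSet L) (hT : IsSemilinearSet T) :
    IsSemilinearSet {d | ∃ c₀ ∈ L, X ∈ c₀ ∧ ∃ ts : Multiset (Multiset σ),
        (∀ t ∈ ts, t ∈ T) ∧ d + Multiset.card ts • {X} = c₀ + ts.sum} := by
  have := addMonoidFG_multiset (σ := σ)
  have hmemX : IsSemilinearSet {c : Multiset σ | X ∈ c} := by
    convert! (IsSemilinearSet.univ (M := Multiset σ)).vadd {X} using 1
    ext c
    simp only [Set.mem_ofPred_eq, Set.mem_vadd_set, Set.mem_univ, true_and, vadd_eq_add,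
      Multiset.singleton_add]
    exact ⟨fun h => (Multiset.exists_cons_of_mem h).imp fun _ h => h.symm,
      fun ⟨e, he⟩ => he ▸ Multiset.mem_cons_self X e⟩
  let i : Multiset σ →+ Multiset σ × ℕ := AddMonoidHom.inl _ _
  let f : Multiset σ × ℕ →+ Multiset σ × ℕ :=
    { toFun := fun p => (p.1 + p.2 • {X}, p.2)
      map_zero' := by simp
      map_add' := fun p q => by
        ext1
        · simp only [Prod.fst_add, Prod.snd_add, add_smul]; abel
        · simp }
  have hP := ((hL.inter hmemX).image i).add
    ((hT.image i).vadd ((0, 1) : Multiset σ × ℕ)).closure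
  convert! (hP.preimage f).image (AddMonoidHom.fst (Multiset σ) ℕ) using 1
  ext d
  simp only [Set.mem_ofPred_eq, Set.mem_image, Set.mem_preimage, Set.mem_add, SetLike.mem_coe]
  constructor
  · rintro ⟨c₀, hc₀, hXc₀, ts, hts, heq⟩
    refine ⟨(d, Multiset.card ts), ⟨i c₀, ⟨c₀, ⟨hc₀, hXc₀⟩, rfl⟩, (ts.sum, Multiset.card ts), ?_, ?_⟩,
      rfl⟩
    · clear heq
      induction ts using Multiset.induction with
      | empty => exact zero_mem _
      | cons t ts ih =>
        simp only [Multiset.mem_cons, forall_eq_or_imp] at hts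
        convert! add_mem (AddSubmonoid.subset_closure
          (Set.vadd_mem_vadd_set (a := ((0, 1) : Multiset σ × ℕ)) (Set.mem_image_of_mem i hts.1)))
          (ih hts.2) using 1
        ext1
        · simp [i]
        · simp [i, add_comm]
    · simp [f, i, heq]
  · rintro ⟨⟨d', n⟩, ⟨_, ⟨c₀, ⟨hc₀, hXc₀⟩, rfl⟩, q, hq, heq⟩, rfl⟩
    have : ∃ ts : Multiset (Multiset σ), (∀ t ∈ ts, t ∈ T) ∧ q = (ts.sum, Multiset.card ts) := by
      clear heq
      induction hq using AddSubmonoid.closure_induction with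
      | mem q hq =>
        obtain ⟨_, ⟨t, ht, rfl⟩, rfl⟩ := hq
        exact ⟨{t}, by simpa, by simp [i]⟩
      | zero => exact ⟨0, by simp, rfl⟩
      | add p q _ _ ihp ihq =>
        obtain ⟨ts₁, h₁, rfl⟩ := ihp
        obtain ⟨ts₂, h₂, rfl⟩ := ihq
        refine ⟨ts₁ + ts₂, fun t ht => ?_, by simp⟩
        exact (Multiset.mem_add.1 ht).elim (h₁ t) (h₂ t)
    obtain ⟨ts, hts, rfl⟩ := this
    simp only [f, i, AddMonoidHom.inl_apply, AddMonoidHom.coe_mk, ZeroHom.coe_mk, Prod.mk_add_mk,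
      Prod.mk.injEq, zero_add] at heq
    exact ⟨c₀, hc₀, hXc₀, ts, hts, by rw [heq.2, heq.1]; rfl⟩

/-- The configurations derivable in a commutative grammar form a semilinear set. -/
theorem isSemilinearSet_commDerives [Finite σ] (hR : R.Finite) (V : Set σ) (c : Multiset σ) :
    IsSemilinearSet {d | CommDerives R V c d} := by
  induction V, V.toFinite using Set.Finite.induction_on generalizing c with
  | empty =>
    convert! IsSemilinearSet.singleton c using 1
    ext d
    refine ⟨fun h => ?_, fun h => h ▸ Relation.ReflTransGen.refl⟩
    induction h with
    | refl => rfl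
    | tail _ h _ => exact absurd h.choose_spec.1 (Set.notMem_empty _)
  | @insert X V hX _ ih =>
    have hT : IsSemilinearSet (replacements R V X) := by
      convert! IsSemilinearSet.biUnion (hR.preimage (f := Prod.mk X)
        (Prod.mk_right_injective X).injOn) (fun r _ => ih r) using 1
      ext t
      simp [replacements]
    convert! (ih c).union (isSemilinearSet_balance X (ih c) hT) using 1
    ext d
    exact commDerives_insert_iff hX

end CommutativeGrammar

/-! ### Parikh's theorem, its converse by regular languages, and two context-free constructions. -/

section Languages

variable {α : Type*}

/-- The commutative (Parikh) image of a language. -/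
def parikhImage (L : Language α) : Set (Multiset α) := {m | ∃ w ∈ L, (w : Multiset α) = m}

section Parikh

open Classical in
/-- Forget the nonterminals outside `V`. -/
noncomputable def symbolClass {N : Type*} (V : Set N) : Symbol α N → α ⊕ Option V
  | .terminal t => .inl t
  | .nonterminal n => .inr (if h : n ∈ V then some ⟨n, h⟩ else none)

/-- The multiset of symbol classes of a sentential form. -/
noncomputable def configuration {N : Type*} (V : Set N) (u : List (Symbol α N)) :
    Multiset (α ⊕ Option V) :=
  ↑(u.map (symbolClass V))

theorem configuration_append {N : Type*} (V : Set N) (u v : List (Symbol α N)) :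
    configuration V (u ++ v) = configuration V u + configuration V v := by
  simp [configuration]

variable (g : ContextFreeGrammar α)

/-- The nonterminals rewritten by a rule of `g`. -/
def ruleInputs : Set g.NT := ContextFreeRule.input '' (g.rules : Set (ContextFreeRule α g.NT))

/-- The rules of the commutative grammar underlying `g`. -/
def commRules : Set ((α ⊕ Option (ruleInputs g)) × Multiset (α ⊕ Option (ruleInputs g))) :=
  (fun r : ContextFreeRule α g.NT => (symbolClass (ruleInputs g) (.nonterminal r.input),
    configuration (ruleInputs g) r.output)) '' (g.rules : Set (ContextFreeRule α g.NT))

variable {g}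

theorem commStep_of_produces {u v : List (Symbol α g.NT)} (h : g.Produces u v) :
    CommStep (commRules g) Set.univ (configuration (ruleInputs g) u)
      (configuration (ruleInputs g) v) := by
  obtain ⟨r, hr, hrw⟩ := h
  obtain ⟨p, q, rfl, rfl⟩ := hrw.exists_parts
  refine ⟨_, trivial, _, ⟨r, hr, rfl⟩, configuration _ p + configuration _ q, ?_, ?_⟩
  · rw [configuration_append, configuration_append]
    simp only [configuration, List.map_cons, List.map_nil, Multiset.coe_singleton]
    abel
  · rw [configuration_append, configuration_append]
    abel

theorem exists_produces_of_commStep {u : List (Symbol α g.NT)}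
    {d : Multiset (α ⊕ Option (ruleInputs g))}
    (h : CommStep (commRules g) Set.univ (configuration (ruleInputs g) u) d) :
    ∃ v, g.Produces u v ∧ configuration (ruleInputs g) v = d := by
  obtain ⟨a, -, _, ⟨r, hr, heq⟩, e, hu, rfl⟩ := h
  obtain ⟨rfl, rfl⟩ := Prod.mk.inj heq
  have hin : r.input ∈ ruleInputs g := ⟨r, hr, rfl⟩
  have hmem : symbolClass (ruleInputs g) (.nonterminal r.input) ∈
      configuration (ruleInputs g) u := by rw [hu]; simp
  -- A rule input is not collapsed to `none`, so its class determines the symbol.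
  have hmem' : Symbol.nonterminal r.input ∈ u := by
    obtain ⟨s, hs, hse⟩ := List.mem_map.1 (Multiset.mem_coe.1 hmem)
    rcases s with t | n
    · simp [symbolClass] at hse
    · by_cases hn : n ∈ ruleInputs g
      · simp only [symbolClass, hn, hin, dite_true, Sum.inr.injEq, Option.some.injEq,
          Subtype.mk.injEq] at hse
        exact hse ▸ hs
      · simp [symbolClass, hn, hin] at hse
  obtain ⟨p, q, rfl⟩ := List.append_of_mem hmem'
  rw [← List.singleton_append, ← List.append_assoc] at hu ⊢
  refine ⟨p ++ r.output ++ q, ⟨r, hr, r.rewrites_of_exists_parts p q⟩, ?_⟩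
  have : e = configuration _ p + configuration _ q := by
    apply add_left_cancel (a := {symbolClass (ruleInputs g) (.nonterminal r.input)})
    rw [← hu, configuration_append, configuration_append]
    simp only [configuration, List.map_cons, List.map_nil, Multiset.coe_singleton]
    abel
  rw [this, configuration_append, configuration_append]
  abel

theorem commDerives_iff {u : List (Symbol α g.NT)} {d : Multiset (α ⊕ Option (ruleInputs g))} :
    CommDerives (commRules g) Set.univ (configuration (ruleInputs g) u) d ↔
      ∃ v, g.Derives u v ∧ configuration (ruleInputs g) v = d := by
  constructor
  · intro h
    induction h with
    | refl => exact ⟨u, Relation.ReflTransGen.refl, rfl⟩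
    | tail _ hstep ih =>
      obtain ⟨v, hv, rfl⟩ := ih
      obtain ⟨w, hw, rfl⟩ := exists_produces_of_commStep hstep
      exact ⟨w, hv.tail hw, rfl⟩
  · rintro ⟨v, hv, rfl⟩
    induction hv with
    | refl => exact Relation.ReflTransGen.refl
    | tail _ hstep ih => exact ih.tail (commStep_of_produces hstep)

/-- **Parikh's theorem**. -/
theorem isSemilinearSet_parikhImage [Finite α] {L : Language α} (hL : L.IsContextFree) :
    IsSemilinearSet (parikhImage L) := by
  obtain ⟨g, rfl⟩ := hL
  -- The type of nonterminals may be infinite; collapsing those without a rule leaves a finite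
  -- symbol set.
  have : Finite (ruleInputs g) := (g.rules.finite_toSet.image _).to_subtype
  have := addMonoidFG_multiset (σ := α)
  have hfin : (commRules g).Finite := g.rules.finite_toSet.image _
  convert! (isSemilinearSet_commDerives hfin Set.univ
    (configuration (ruleInputs g) [.nonterminal g.initial])).preimage
    (Multiset.mapAddMonoidHom (Sum.inl : α → α ⊕ Option (ruleInputs g))) using 1
  ext m
  simp only [parikhImage, Set.mem_ofPred_eq, Set.mem_preimage, commDerives_iff,
    Multiset.coe_mapAddMonoidHom]
  constructor
  · rintro ⟨w, hw, rfl⟩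
    exact ⟨_, hw, by
      rw [configuration, List.map_map, Multiset.map_coe]; rfl⟩
  · rintro ⟨v, hv, hvm⟩
    have hterm : ∀ v : List (Symbol α g.NT),
        (∀ s ∈ configuration (ruleInputs g) v, ∃ t, s = Sum.inl t) →
          ∃ w : List α, v = w.map Symbol.terminal := by
      intro v
      induction v with
      | nil => exact fun _ => ⟨[], rfl⟩
      | cons s v ih =>
        intro h
        simp only [configuration, List.map_cons, Multiset.mem_coe, List.mem_cons,
          forall_eq_or_imp] at h
        obtain ⟨w, rfl⟩ := ih (by simpa [configuration] using h.2)
        rcases s with t | n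
        · exact ⟨t :: w, rfl⟩
        · obtain ⟨t, ht⟩ := h.1
          simp [symbolClass] at ht
    obtain ⟨w, rfl⟩ := hterm v (fun s hs => by
      rw [hvm, Multiset.mem_map] at hs
      exact hs.imp fun _ h => h.2.symm)
    refine ⟨w, hv, Multiset.map_injective (Sum.inl_injective (β := Option (ruleInputs g))) ?_⟩
    rw [← hvm, configuration, List.map_map, Multiset.map_coe]; rfl

end Parikh

/-- Myhill–Nerode: closure under quotients by letters puts all left quotients of `L` in the finite
family. -/
theorem isRegular_of_finite_of_leftQuotient_mem {F : Set (Language α)} (hF : F.Finite)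
    (h : ∀ L ∈ F, ∀ a, L.leftQuotient [a] ∈ F) {L : Language α} (hL : L ∈ F) : L.IsRegular := by
  refine .of_finite_range_leftQuotient (hF.subset ?_)
  rintro _ ⟨x, rfl⟩
  induction x using List.reverseRecOn with
  | nil => exact hL
  | append_singleton x a ih => exact L.leftQuotient_append x [a] ▸ h _ ih a

open scoped Computability in
-- The family `E * S∗`, with `E` a set of suffixes of words of `D` or `S`, is finite and closed
-- under quotients by letters.
theorem isRegular_mul_kstar {D S : Language α} (hD : Set.Finite {w | w ∈ D})
    (hS : Set.Finite {w | w ∈ S}) : (D * S∗).IsRegular := by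
  let F : Set (List α) := {v | ∃ u, (u ∈ D ∨ u ∈ S) ∧ v <:+ u}
  have hF : F.Finite := by
    convert! (hD.union hS).biUnion (t := fun u => {v | v ∈ u.tails})
      (fun u _ => List.finite_toSet _) using 1
    ext v
    simp [F]
  have htail : ∀ a v, a :: v ∈ F → v ∈ F := fun a v ⟨u, hu, hv⟩ =>
    ⟨u, hu, (List.suffix_cons a v).trans hv⟩
  refine isRegular_of_finite_of_leftQuotient_mem
    (F := (fun E : Language α => E * S∗) '' {E : Set (List α) | E ⊆ F})
    (hF.finite_subsets.image _) ?_ ⟨D, fun v hv => ⟨v, Or.inl hv, List.suffix_rfl⟩, rfl⟩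
  rintro _ ⟨E, hE, rfl⟩ a
  -- Reading `a` either advances inside a word of `E` or, if `E` contains the empty word, opens a
  -- new word of `S`.
  refine ⟨{v | a :: v ∈ E ∨ ([] ∈ E ∧ a :: v ∈ S)}, ?_, ?_⟩
  · rintro v (hv | ⟨-, hv⟩)
    · exact htail a v (hE hv)
    · exact htail a v ⟨_, Or.inr hv, List.suffix_rfl⟩
  ext w
  simp only [Language.mem_leftQuotient, List.singleton_append]
  constructor
  · rintro ⟨v, hv, s, hs, rfl⟩
    rcases hv with hv | ⟨hnil, hv⟩
    · exact ⟨a :: v, hv, s, hs, rfl⟩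
    · obtain ⟨l, rfl, hl⟩ := hs
      exact ⟨[], hnil, _, ⟨(a :: v) :: l, rfl, by
        simp only [List.mem_cons, forall_eq_or_imp]; exact ⟨hv, hl⟩⟩, by simp⟩
  · rintro ⟨v, hv, s, hs, heq⟩
    rcases v with _ | ⟨b, v⟩
    · simp only [List.nil_append] at heq
      subst heq
      obtain ⟨l, hl, hlS⟩ := Language.mem_kstar_iff_exists_nonempty.1 hs
      rcases l with _ | ⟨u, l⟩
      · simp at hl
      · simp only [List.mem_cons, forall_eq_or_imp] at hlS
        rcases u with _ | ⟨b, u⟩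
        · exact absurd rfl hlS.1.2
        · simp only [List.flatten_cons, List.cons_append, List.cons.injEq] at hl
          obtain ⟨rfl, rfl⟩ := hl
          exact ⟨u, Or.inr ⟨hv, hlS.1.1⟩, _, ⟨l, rfl, fun y hy => (hlS.2 y hy).1⟩, rfl⟩
    · simp only [List.cons_append, List.cons.injEq] at heq
      obtain ⟨rfl, rfl⟩ := heq
      exact ⟨v, Or.inl hv, s, hs, rfl⟩

open scoped Computability Pointwise in
-- The base point and the finitely many periods are written as words in any order; the linear set is
-- then the commutative image of base word times star of period words.
theorem exists_isRegular_parikhImage_eq_of_isLinearSet {S : Set (Multiset α)}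
    (hS : IsLinearSet S) : ∃ L : Language α, L.IsRegular ∧ parikhImage L = S := by
  obtain ⟨a, t, ht, rfl⟩ := hS
  refine ⟨_, isRegular_mul_kstar (Set.finite_singleton a.toList) (ht.image Multiset.toList), ?_⟩
  ext m
  simp only [parikhImage, Set.mem_ofPred_eq, Set.mem_vadd_set, SetLike.mem_coe, vadd_eq_add]
  constructor
  · rintro ⟨_, ⟨_, rfl, _, ⟨l, rfl, hl⟩, rfl⟩, rfl⟩
    refine ⟨(l.flatten : Multiset α), ?_, by simp [← Multiset.coe_add]⟩
    induction l with
    | nil => exact zero_mem _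
    | cons u l ih =>
      simp only [List.mem_cons, forall_eq_or_imp] at hl
      obtain ⟨⟨m, hm, rfl⟩, hl⟩ := hl
      rw [List.flatten_cons, ← Multiset.coe_add, Multiset.coe_toList]
      exact add_mem (AddSubmonoid.subset_closure hm) (ih hl)
  · rintro ⟨m, hm, rfl⟩
    have : ∃ l : List (List α), (∀ y ∈ l, y ∈ Multiset.toList '' t) ∧
        (l.flatten : Multiset α) = m := by
      induction hm using AddSubmonoid.closure_induction with
      | mem x hx => exact ⟨[x.toList], by simpa using ⟨x, hx, rfl⟩, by simp⟩
      | zero => exact ⟨[], by simp, rfl⟩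
      | add x y _ _ ihx ihy =>
        obtain ⟨l₁, h₁, rfl⟩ := ihx
        obtain ⟨l₂, h₂, rfl⟩ := ihy
        refine ⟨l₁ ++ l₂, fun y hy => ?_, by simp⟩
        exact (List.mem_append.1 hy).elim (h₁ y) (h₂ y)
    obtain ⟨l, hl, rfl⟩ := this
    exact ⟨a.toList ++ l.flatten, ⟨_, rfl, _, ⟨l, rfl, hl⟩, rfl⟩, by simp [← Multiset.coe_add]⟩

theorem isRegular_empty : (0 : Language α).IsRegular := by
  simpa using isRegular_mul_kstar (α := α) (D := 0) (S := 0) (by simp) (by simp)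

theorem exists_isRegular_parikhImage_eq {S : Set (Multiset α)} (hS : IsSemilinearSet S) :
    ∃ L : Language α, L.IsRegular ∧ parikhImage L = S := by
  obtain ⟨S, hfin, hS, rfl⟩ := hS
  induction S, hfin using Set.Finite.induction_on with
  | empty => exact ⟨0, isRegular_empty, by ext; simp [parikhImage]⟩
  | @insert s S _ _ ih =>
    obtain ⟨L₁, hL₁, h₁⟩ := exists_isRegular_parikhImage_eq_of_isLinearSet (hS s (by simp))
    obtain ⟨L₂, hL₂, h₂⟩ := ih fun t ht => hS t (by simp [ht])
    refine ⟨L₁ + L₂, hL₁.add hL₂, ?_⟩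
    rw [Set.sUnion_insert, ← h₁, ← h₂]
    ext m
    simp only [parikhImage, Set.mem_ofPred_eq, Set.mem_union, Language.mem_add]
    simp only [or_and_right, exists_or]

section LinearGrammar

variable {N : Type*} {r : ContextFreeRule α N}

theorem not_rewrites_map_terminal (w : List α) (v : List (Symbol α N)) :
    ¬ r.Rewrites (w.map .terminal) v := fun h => by
  simpa using h.nonterminal_input_mem

theorem rewrites_linear {x y : List α} {A : N} {v : List (Symbol α N)}
    (h : r.Rewrites (x.map .terminal ++ .nonterminal A :: y.map .terminal) v) :
    r.input = A ∧ v = x.map .terminal ++ r.output ++ y.map .terminal := by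
  induction x generalizing v with
  | nil =>
    cases h with
    | head => exact ⟨rfl, by simp⟩
    | cons _ h => exact absurd h (not_rewrites_map_terminal y _)
  | cons a x ih =>
    cases h with
    | cons _ h =>
      obtain ⟨h₁, rfl⟩ := ih h
      exact ⟨h₁, by simp⟩

theorem map_terminal_injective :
    Function.Injective (List.map (Symbol.terminal : α → Symbol α N)) :=
  List.map_injective_iff.2 fun _ _ h => Symbol.terminal.inj h

theorem map_terminal_ne (w x y : List α) (A : N) :
    w.map Symbol.terminal ≠ x.map Symbol.terminal ++ .nonterminal A :: y.map .terminal := by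
  intro h
  have : (Symbol.nonterminal A : Symbol α N) ∈ w.map .terminal := by rw [h]; simp
  simp at this

end LinearGrammar

/-- The states of a DFA serve as nonterminals of a right-linear grammar; after producing `w` the
only nonterminal is `M.eval w`. -/
theorem isContextFree_of_isRegular [Finite α] {L : Language α} (hL : L.IsRegular) :
    L.IsContextFree := by
  classical
  have := Fintype.ofFinite α
  obtain ⟨Q, _, M, rfl⟩ := hL
  let rules : Finset (ContextFreeRule α Q) :=
    (Finset.univ.image fun p : Q × α => ⟨p.1, [.terminal p.2, .nonterminal (M.step p.1 p.2)]⟩) ∪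
      (Finset.univ.filter (· ∈ M.accept)).image fun q => ⟨q, []⟩
  have hrules : ∀ r, r ∈ rules ↔
      (∃ q a, r = ⟨q, [.terminal a, .nonterminal (M.step q a)]⟩) ∨ ∃ q ∈ M.accept, r = ⟨q, []⟩ := by
    intro r
    simp [rules, eq_comm]
  clear_value rules
  refine ⟨⟨Q, M.start, rules⟩, ?_⟩
  ext w
  constructor
  · have key : ∀ v : List (Symbol α Q),
        (⟨Q, M.start, rules⟩ : ContextFreeGrammar α).Derives [.nonterminal M.start] v →
        (∃ w : List α, v = w.map .terminal ++ .nonterminal (M.eval w) :: ([] : List α).map .terminal) ∨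
          ∃ w ∈ M.accepts, v = w.map .terminal := by
      intro v h
      induction h with
      | refl => exact Or.inl ⟨[], rfl⟩
      | tail _ hstep ih =>
        obtain ⟨r, hr, hrw⟩ := hstep
        rcases ih with ⟨w, rfl⟩ | ⟨w, -, rfl⟩
        · obtain ⟨hin, rfl⟩ := rewrites_linear hrw
          rcases (hrules r).1 hr with ⟨q, a, rfl⟩ | ⟨q, hq, rfl⟩ <;> subst hin
          · exact Or.inl ⟨w ++ [a], by simp⟩
          · exact Or.inr ⟨w, hq, by simp⟩
        · exact absurd hrw (not_rewrites_map_terminal w _)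
    intro h
    rcases key _ h with ⟨v, hv⟩ | ⟨v, hv, hvw⟩
    · exact absurd hv (map_terminal_ne _ _ _ _)
    · exact map_terminal_injective hvw ▸ hv
  · intro hw
    have key : ∀ w : List α, (⟨Q, M.start, rules⟩ : ContextFreeGrammar α).Derives
        [.nonterminal M.start] (w.map .terminal ++ [.nonterminal (M.eval w)]) := by
      intro w
      induction w using List.reverseRecOn with
      | nil => exact Relation.ReflTransGen.refl
      | append_singleton w a ih =>
        refine ih.tail ⟨_, (hrules _).2 (Or.inl ⟨M.eval w, a, rfl⟩), ?_⟩
        rw [ContextFreeRule.rewrites_iff]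
        exact ⟨w.map .terminal, [], by simp, by simp⟩
    refine (key w).tail ⟨_, (hrules _).2 (Or.inr ⟨M.eval w, hw, rfl⟩), ?_⟩
    rw [ContextFreeRule.rewrites_iff]
    exact ⟨w.map .terminal, [], by simp, by simp⟩

theorem isContextFree_replicate_append (x z y : α) :
    Language.IsContextFree {w : List α | ∃ k : ℕ,
      w = List.replicate k x ++ z :: List.replicate k y} := by
  classical
  let r₁ : ContextFreeRule α Unit := ⟨(), [.terminal x, .nonterminal (), .terminal y]⟩
  let r₂ : ContextFreeRule α Unit := ⟨(), [.terminal z]⟩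
  refine ⟨⟨Unit, (), {r₁, r₂}⟩, ?_⟩
  ext w
  constructor
  · have key : ∀ v : List (Symbol α Unit),
        (⟨Unit, (), {r₁, r₂}⟩ : ContextFreeGrammar α).Derives [.nonterminal ()] v →
        (∃ k : ℕ, v = (List.replicate k x).map .terminal ++
          .nonterminal () :: (List.replicate k y).map .terminal) ∨
          ∃ k : ℕ, v = (List.replicate k x ++ z :: List.replicate k y).map .terminal := by
      intro v h
      induction h with
      | refl => exact Or.inl ⟨0, rfl⟩
      | tail _ hstep ih =>
        obtain ⟨r, hr, hrw⟩ := hstep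
        rcases ih with ⟨k, rfl⟩ | ⟨k, rfl⟩
        · obtain ⟨-, rfl⟩ := rewrites_linear hrw
          rcases Finset.mem_insert.1 hr with rfl | hr
          · exact Or.inl ⟨k + 1, by
              rw [List.replicate_succ' (a := x), List.replicate_succ (a := y)]; simp [r₁]⟩
          · obtain rfl := Finset.mem_singleton.1 hr
            exact Or.inr ⟨k, by simp [r₂]⟩
        · exact absurd hrw (not_rewrites_map_terminal _ _)
    intro h
    rcases key _ h with ⟨k, hk⟩ | ⟨k, hk⟩
    · exact absurd hk (map_terminal_ne _ _ _ _)
    · exact ⟨k, map_terminal_injective hk⟩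
  · rintro ⟨k, rfl⟩
    have key : ∀ k : ℕ, (⟨Unit, (), {r₁, r₂}⟩ : ContextFreeGrammar α).Derives [.nonterminal ()]
        ((List.replicate k x).map .terminal ++
          [.nonterminal ()] ++ (List.replicate k y).map .terminal) := by
      intro k
      induction k with
      | zero => exact Relation.ReflTransGen.refl
      | succ k ih =>
        refine ih.tail ⟨r₁, Finset.mem_insert_self _ _, ?_⟩
        rw [ContextFreeRule.rewrites_iff]
        exact ⟨_, _, rfl, by
          rw [List.replicate_succ' (a := x), List.replicate_succ (a := y)]; simp [r₁]⟩
    refine (key k).tail ⟨r₂, Finset.mem_insert_of_mem (Finset.mem_singleton_self _), ?_⟩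
    rw [ContextFreeRule.rewrites_iff]
    exact ⟨_, _, rfl, by simp [r₂]⟩

end Languages

universe u

/-! ### Algebraic subsets of commutative groups and of cyclic extensions. -/

section Groups

variable {G : Type u} [Group G]

theorem wordValue_append (A : Finset G) (v w : List (A × Bool)) :
    wordValue A (v ++ w) = wordValue A v * wordValue A w := by
  simp [wordValue]

theorem wordValue_replicate (A : Finset G) (k : ℕ) (x : A × Bool) :
    wordValue A (List.replicate k x) = wordValue A [x] ^ k := by
  simp [wordValue]

theorem exists_addMonoidHom_wordValue {B : Type*} [CommGroup B] (A : Finset G) (f : G →* B) :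
    ∃ F : Multiset (A × Bool) →+ Additive B, ∀ w : List (A × Bool),
      F w = Additive.ofMul (f (wordValue A w)) := by
  refine ⟨Multiset.sumAddMonoidHom.comp (Multiset.mapAddMonoidHom fun x : A × Bool =>
    Additive.ofMul (f (if x.2 then (x.1 : G) else (x.1 : G)⁻¹))), fun w => ?_⟩
  induction w with
  | nil => simp [wordValue]
  | cons x w ih =>
    rw [← List.singleton_append, wordValue_append, map_mul, ofMul_mul, ← ih,
      ← Multiset.coe_add, map_add]
    simp [wordValue]

/-- The image of an algebraic subset in a commutative group is semilinear. -/
theorem IsAlgebraicSubset.isSemilinearSet_image {B : Type*} [CommGroup B] {K : Set G}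
    (hK : IsAlgebraicSubset K) (f : G →* B) :
    IsSemilinearSet ((fun x => Additive.ofMul (f x)) '' K) := by
  obtain ⟨A, -, L, hL, rfl⟩ := hK
  obtain ⟨F, hF⟩ := exists_addMonoidHom_wordValue A f
  convert! (isSemilinearSet_parikhImage hL).image F using 1
  ext b
  constructor
  · rintro ⟨_, ⟨w, hw, rfl⟩, rfl⟩
    exact ⟨w, ⟨w, hw, rfl⟩, hF w⟩
  · rintro ⟨_, ⟨w, hw, rfl⟩, rfl⟩
    exact ⟨_, ⟨w, hw, rfl⟩, (hF w).symm⟩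

theorem IsRationalSubset.isAlgebraicSubset {K : Set G} (hK : IsRationalSubset K) :
    IsAlgebraicSubset K := by
  obtain ⟨A, hA, L, hL, rfl⟩ := hK
  exact ⟨A, hA, L, isContextFree_of_isRegular hL, rfl⟩

/-- A regular language with the same Parikh image has the same set of values, since evaluation
factors through multisets. -/
theorem IsAlgebraicSubset.isRationalSubset {B : Type*} [CommGroup B] {K : Set B}
    (hK : IsAlgebraicSubset K) : IsRationalSubset K := by
  obtain ⟨A, hA, L, hL, rfl⟩ := hK
  obtain ⟨L', hL', h⟩ := exists_isRegular_parikhImage_eq (isSemilinearSet_parikhImage hL)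
  obtain ⟨F, hF⟩ := exists_addMonoidHom_wordValue A (MonoidHom.id B)
  have key : ∀ L : Language (A × Bool),
      wordValue A '' {w | w ∈ L} = (fun m => (F m).toMul) '' parikhImage L := by
    intro L
    ext b
    constructor
    · rintro ⟨w, hw, rfl⟩
      exact ⟨w, ⟨w, hw, rfl⟩, by simp [hF]⟩
    · rintro ⟨_, ⟨w, hw, rfl⟩, rfl⟩
      exact ⟨w, hw, by simp [hF]⟩
  exact ⟨A, hA, L', hL', by rw [key, key, h]⟩

/-- In a commutative group the algebraic subsets are the rational ones. -/
theorem alg_eq_rat (B : Type u) [CommGroup B] : Alg B = Rat B :=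
  Set.ext fun _ => ⟨IsAlgebraicSubset.isRationalSubset, IsRationalSubset.isAlgebraicSubset⟩

theorem inr_pow_conj (φ : MulAut G) (g : G) (k : ℕ) :
    (SemidirectProduct.inr (Multiplicative.ofAdd 1) : ZExtension G φ)⁻¹ ^ k *
      SemidirectProduct.inl g * SemidirectProduct.inr (Multiplicative.ofAdd 1) ^ k =
      SemidirectProduct.inl ((φ ^ k) g) := by
  induction k with
  | zero => simp
  | succ k ih =>
    rw [pow_succ', pow_succ, pow_succ', MulAut.mul_apply, ← conj_eq, ← ih]
    simp only [mul_assoc]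

open Classical in
/-- A finite generating set of `G` together with the stable letter. -/
noncomputable def zExtensionGenerators (φ : MulAut G) (A : Finset G) : Finset (ZExtension G φ) :=
  insert (SemidirectProduct.inr (Multiplicative.ofAdd 1)) (A.image SemidirectProduct.inl)

theorem closure_zExtensionGenerators (φ : MulAut G) {A : Finset G}
    (hA : Subgroup.closure (A : Set G) = ⊤) :
    Subgroup.closure (zExtensionGenerators φ A : Set (ZExtension G φ)) = ⊤ := by
  refine eq_top_iff.2 fun x _ => ?_
  rw [← SemidirectProduct.inl_left_mul_inr_right x]
  refine mul_mem ?_ ?_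
  · have hmap : (Subgroup.closure (A : Set G)).map
        (SemidirectProduct.inl : G →* ZExtension G φ) ≤
          Subgroup.closure (zExtensionGenerators φ A : Set (ZExtension G φ)) := by
      rw [MonoidHom.map_closure]
      exact Subgroup.closure_mono (by simp [zExtensionGenerators])
    exact hmap ⟨x.left, by rw [hA]; trivial, rfl⟩
  · have : x.right = Multiplicative.ofAdd 1 ^ (x.right.toAdd) := by
      rw [← ofAdd_zsmul]; simp
    rw [this, map_zpow]
    exact zpow_mem (Subgroup.subset_closure (by simp [zExtensionGenerators])) _

/-- The orbit of an element of `G` is an algebraic subset of `G ⋊_φ ℤ`. -/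
theorem isAlgebraicSubset_inl_autOrbit [Group.FG G] (φ : MulAut G) (g : G) :
    IsAlgebraicSubset ((SemidirectProduct.inl : G →* ZExtension G φ) '' autOrbit φ g) := by
  classical
  obtain ⟨A, hA⟩ := Group.fg_def.1 ‹Group.FG G›
  -- Adjoining `g` to the generators makes it a single letter.
  let A' := insert g A
  have hA' : Subgroup.closure (A' : Set G) = ⊤ :=
    top_le_iff.1 (hA.symm.le.trans (Subgroup.closure_mono (by simp [A'])))
  let E := zExtensionGenerators φ A'
  let t : E := ⟨SemidirectProduct.inr (Multiplicative.ofAdd 1), Finset.mem_insert_self _ _⟩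
  let a : E := ⟨SemidirectProduct.inl g, Finset.mem_insert_of_mem
    (Finset.mem_image_of_mem _ (Finset.mem_insert_self _ _))⟩
  refine ⟨E, closure_zExtensionGenerators φ hA', _,
    isContextFree_replicate_append (t, false) (a, true) (t, true), ?_⟩
  have hval : ∀ k : ℕ, wordValue E (List.replicate k (t, false) ++
      (a, true) :: List.replicate k (t, true)) = SemidirectProduct.inl ((φ ^ k) g) := by
    intro k
    rw [← List.singleton_append, wordValue_append, wordValue_append, wordValue_replicate,
      wordValue_replicate, ← inr_pow_conj, mul_assoc]
    simp [wordValue, t, a]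
  ext x
  constructor
  · rintro ⟨_, ⟨k, rfl⟩, rfl⟩
    exact ⟨_, ⟨k, rfl⟩, (hval k).symm⟩
  · rintro ⟨_, ⟨k, rfl⟩, rfl⟩
    exact ⟨_, ⟨k, rfl⟩, hval k⟩

theorem zExtension_fg [Group.FG G] (φ : MulAut G) : Group.FG (ZExtension G φ) := by
  obtain ⟨A, hA⟩ := Group.fg_def.1 ‹Group.FG G›
  exact Group.fg_def.2 ⟨_, closure_zExtensionGenerators φ hA⟩

end Groups

/-! ### Powers of `Q` and the odd-indexed Fibonacci numbers. -/

section Fibonacci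

theorem Q_pow_succ (k : ℕ) : (Q : Matrix (Fin 2) (Fin 2) ℤ) ^ (k + 1) =
    !![(Nat.fib (2 * k + 3) : ℤ), (Nat.fib (2 * k + 2) : ℤ);
       (Nat.fib (2 * k + 2) : ℤ), (Nat.fib (2 * k + 1) : ℤ)] := by
  induction k with
  | zero => simp [Q, Nat.fib_add_two]
  | succ k ih =>
    have h₂ : Nat.fib (2 * k + 3) = Nat.fib (2 * k + 1) + Nat.fib (2 * k + 2) := Nat.fib_add_two
    have h₃ : Nat.fib (2 * (k + 1) + 2) = Nat.fib (2 * k + 2) + Nat.fib (2 * k + 3) :=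
      Nat.fib_add_two
    have h₄ : Nat.fib (2 * (k + 1) + 3) = Nat.fib (2 * k + 3) + Nat.fib (2 * (k + 1) + 2) :=
      Nat.fib_add_two
    rw [pow_succ, ih, h₄, h₃, show 2 * (k + 1) + 1 = 2 * k + 3 by ring, h₂]
    ext i j
    fin_cases i <;> fin_cases j <;> simp [Q, Matrix.mul_apply, Fin.sum_univ_two] <;> ring

theorem Q_pow_row_zero (k : ℕ) : ((Q : Matrix (Fin 2) (Fin 2) ℤ) ^ k) 0 =
    ![(Nat.fib (2 * k + 1) : ℤ), (Nat.fib (2 * k) : ℤ)] := by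
  cases k with
  | zero => ext i; fin_cases i <;> simp
  | succ k => rw [Q_pow_succ]; rfl

theorem rowAut_pow_apply (M : GL (Fin 2) ℤ) (k : ℕ) (v : Fin 2 → ℤ) :
    (rowAut M ^ k) (Multiplicative.ofAdd v) =
      Multiplicative.ofAdd (v ᵥ* (M : Matrix (Fin 2) (Fin 2) ℤ) ^ k) := by
  induction k generalizing v with
  | zero => simp
  | succ k ih =>
    rw [pow_succ, MulAut.mul_apply, pow_succ', ← Matrix.vecMul_vecMul, ← ih]
    rfl

theorem autOrbit_rowAut (M : GL (Fin 2) ℤ) :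
    autOrbit (rowAut M) (Multiplicative.ofAdd ![1, 0]) =
      Set.range fun k : ℕ => Multiplicative.ofAdd (((M : Matrix (Fin 2) (Fin 2) ℤ) ^ k) 0) := by
  have key : ∀ k : ℕ, (rowAut M ^ k) (Multiplicative.ofAdd ![1, 0]) =
      Multiplicative.ofAdd (((M : Matrix (Fin 2) (Fin 2) ℤ) ^ k) 0) := by
    intro k
    rw [rowAut_pow_apply]
    congr 1
    ext j
    simp [Matrix.vecMul, dotProduct, Fin.sum_univ_two]
  ext x
  simp [autOrbit, key, eq_comm]

/-- An infinite semilinear set contains an infinite arithmetic progression. -/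
theorem exists_progression_of_infinite {M : Type*} [AddCommMonoid M] {S : Set M}
    (hS : IsSemilinearSet S) (hinf : S.Infinite) : ∃ a p : M, p ≠ 0 ∧ ∀ n : ℕ, a + n • p ∈ S := by
  obtain ⟨F, hF, hlin, rfl⟩ := hS
  obtain ⟨s, hs, hsinf⟩ : ∃ s ∈ F, s.Infinite := by
    by_contra! h
    exact hinf (hF.sUnion h)
  obtain ⟨a, t, -, rfl⟩ := hlin s hs
  obtain ⟨p, hp, hp0⟩ : ∃ p ∈ t, p ≠ 0 := by
    by_contra! h
    have : AddSubmonoid.closure t = ⊥ :=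
      le_bot_iff.1 (AddSubmonoid.closure_le.2 fun x hx => h x hx)
    rw [this] at hsinf
    exact hsinf (by simp)
  exact ⟨a, p, hp0, fun n => ⟨_, hs, n • p,
    nsmul_mem (AddSubmonoid.subset_closure hp) n, rfl⟩⟩

/-- The gap after $f_{2k+1}$ is $f_{2k+2}\ge f_{2k+1}$, whereas a progression of difference `p`
would force a gap of at most `p` after arbitrarily large terms. -/
theorem not_isSemilinearSet_fib_odd :
    ¬ IsSemilinearSet (Set.range fun k : ℕ => (Nat.fib (2 * k + 1) : ℤ)) := by
  intro h
  have hmono : StrictMono fun k : ℕ => (Nat.fib (2 * k + 1) : ℤ) := by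
    refine strictMono_nat_of_lt_succ fun k => ?_
    have h₁ : Nat.fib (2 * (k + 1) + 1) = Nat.fib (2 * k + 1) + Nat.fib (2 * k + 2) :=
      Nat.fib_add_two
    have h₂ : 0 < Nat.fib (2 * k + 2) := Nat.fib_pos.2 (by lia)
    lia
  obtain ⟨a, p, hp, hmem⟩ := exists_progression_of_infinite h
    (Set.infinite_range_of_injective hmono.injective)
  have hnonneg : ∀ n : ℕ, 0 ≤ a + n * p := fun n => by
    obtain ⟨k, hk⟩ := hmem n
    simp only [nsmul_eq_mul] at hk
    rw [← hk]
    positivity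
  have hpos : 0 < p := by
    by_contra hneg
    have h₁ := hnonneg (a.toNat + 1)
    have h₂ := hnonneg 0
    push_cast at h₁ h₂
    have : (a.toNat : ℤ) = a := Int.toNat_of_nonneg (by linarith)
    rw [this] at h₁
    have : p ≤ -1 := by lia
    nlinarith
  -- This index makes the term exceed `p`: as `p ≥ 1`, the summand `a.natAbs * p` outweighs a
  -- negative `a`.
  obtain ⟨k, hk⟩ := hmem (2 * p.toNat + 3 + a.natAbs)
  simp only [nsmul_eq_mul, Nat.cast_add, Nat.cast_mul, Nat.cast_ofNat] at hk
  obtain ⟨l, hl⟩ := hmem (2 * p.toNat + 3 + a.natAbs + 1)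
  simp only [nsmul_eq_mul, Nat.cast_add, Nat.cast_mul, Nat.cast_ofNat, Nat.cast_one] at hl
  have hkl : (Nat.fib (2 * l + 1) : ℤ) = Nat.fib (2 * k + 1) + p := by rw [hl, hk]; ring
  have hlt : k < l := by
    have : (fun k : ℕ => (Nat.fib (2 * k + 1) : ℤ)) k < (fun k : ℕ => (Nat.fib (2 * k + 1) : ℤ)) l := by
      simp only; linarith
    exact hmono.lt_iff_lt.1 this
  have h₁ : (Nat.fib (2 * (k + 1) + 1) : ℤ) ≤ Nat.fib (2 * l + 1) := hmono.monotone hlt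
  have h₂ : Nat.fib (2 * (k + 1) + 1) = Nat.fib (2 * k + 1) + Nat.fib (2 * k + 2) :=
    Nat.fib_add_two
  have h₃ : Nat.fib (2 * k + 1) ≤ Nat.fib (2 * k + 2) := Nat.fib_le_fib_succ
  have h₄ : p < Nat.fib (2 * k + 1) := by
    rw [hk]
    have e₁ : ((p.toNat : ℕ) : ℤ) = p := Int.toNat_of_nonneg hpos.le
    have e₂ : ((a.natAbs : ℕ) : ℤ) = |a| := Int.natCast_natAbs a
    rw [e₁, e₂]
    nlinarith [neg_abs_le a, abs_nonneg a]
  lia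

end Fibonacci

/-! ### The orbit of $(1,0)$ and the failure of the Fatou property. -/

section Counterexample

/-- The projection of `ℤ²` to the first coordinate. -/
def firstCoordinate : Z2 →* Multiplicative ℤ :=
  AddMonoidHom.toMultiplicative (Pi.evalAddMonoidHom (fun _ : Fin 2 => ℤ) 0)

theorem autOrbit_Q : autOrbit (rowAut Q) (Multiplicative.ofAdd ![1, 0]) =
    Set.range fun k : ℕ =>
      Multiplicative.ofAdd ![(Nat.fib (2 * k + 1) : ℤ), (Nat.fib (2 * k) : ℤ)] := by
  rw [autOrbit_rowAut]
  simp only [Q_pow_row_zero]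

/-- No algebraic subset of a group projects onto the orbit of `(1, 0)`. -/
theorem not_isAlgebraicSubset_of_image_eq_autOrbit {H : Type u} [Group H] (f : H →* Z2) {K : Set H}
    (hK : f '' K = autOrbit (rowAut Q) (Multiplicative.ofAdd ![1, 0])) :
    ¬ IsAlgebraicSubset K := by
  intro h
  have hs := (h.isSemilinearSet_image (firstCoordinate.comp f)).image
    (AddEquiv.additiveMultiplicative ℤ)
  apply not_isSemilinearSet_fib_odd
  convert! hs using 1
  have himg : (fun x => Additive.ofMul ((firstCoordinate.comp f) x)) '' K =
      (fun v => Additive.ofMul (firstCoordinate v)) '' (f '' K) := by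
    rw [Set.image_image]; rfl
  rw [himg, hK, autOrbit_Q, ← Set.range_comp, ← Set.range_comp]
  rfl

end Counterexample

end HerbstFatou

theorem mainTheorem2 :
    -- the powers of `Q` have Fibonacci numbers as entries
    (∀ k : ℕ, 1 ≤ k → (HerbstFatou.Q : Matrix (Fin 2) (Fin 2) ℤ) ^ k =
      !![(Nat.fib (2 * k + 1) : ℤ), (Nat.fib (2 * k) : ℤ);
         (Nat.fib (2 * k) : ℤ), (Nat.fib (2 * k - 1) : ℤ)]) ∧
    -- the orbit of `(1, 0)` is the set of first rows of powers of `Q`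
    HerbstFatou.autOrbit (HerbstFatou.rowAut HerbstFatou.Q) (Multiplicative.ofAdd ![1, 0]) =
      Set.range (fun k : ℕ =>
        Multiplicative.ofAdd (((HerbstFatou.Q : Matrix (Fin 2) (Fin 2) ℤ) ^ k) 0)) ∧
    HerbstFatou.autOrbit (HerbstFatou.rowAut HerbstFatou.Q) (Multiplicative.ofAdd ![1, 0]) =
      Set.range (fun k : ℕ =>
        Multiplicative.ofAdd ![(Nat.fib (2 * k + 1) : ℤ), (Nat.fib (2 * k) : ℤ)]) ∧
    -- rational and algebraic subsets of `ℤ²` coincide, and the orbit is not one of them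
    HerbstFatou.Alg HerbstFatou.Z2 = HerbstFatou.Rat HerbstFatou.Z2 ∧
    HerbstFatou.autOrbit (HerbstFatou.rowAut HerbstFatou.Q) (Multiplicative.ofAdd ![1, 0]) ∉
      HerbstFatou.Rat HerbstFatou.Z2 ∧
    HerbstFatou.autOrbit (HerbstFatou.rowAut HerbstFatou.Q) (Multiplicative.ofAdd ![1, 0]) ∉
      HerbstFatou.Alg HerbstFatou.Z2 ∧
    -- the Fatou property for algebraic subsets fails for `ℤ² ≤ ℤ² ⋊_Q ℤ`
    HerbstFatou.Alg HerbstFatou.Z2 ≠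
      {K : Set HerbstFatou.Z2 |
        (SemidirectProduct.inl : HerbstFatou.Z2 →*
            HerbstFatou.ZExtension HerbstFatou.Z2 (HerbstFatou.rowAut HerbstFatou.Q)) '' K ∈
          HerbstFatou.Alg
            (HerbstFatou.ZExtension HerbstFatou.Z2 (HerbstFatou.rowAut HerbstFatou.Q))} ∧
    -- negative answer to the general question, even for finitely generated groups
    ¬ ∀ (G : Type) [Group G] [Group.FG G] (H : Subgroup G), H.FG →
        HerbstFatou.Alg H =
          {K : Set H | (Subtype.val : H → G) '' K ∈ HerbstFatou.Alg G} := by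
  have horb : HerbstFatou.autOrbit (HerbstFatou.rowAut HerbstFatou.Q)
      (Multiplicative.ofAdd ![1, 0]) ∉ HerbstFatou.Alg HerbstFatou.Z2 :=
    HerbstFatou.not_isAlgebraicSubset_of_image_eq_autOrbit (MonoidHom.id _) (by simp)
  have hfg : Group.FG HerbstFatou.Z2 := inferInstance
  have hext := HerbstFatou.isAlgebraicSubset_inl_autOrbit (HerbstFatou.rowAut HerbstFatou.Q)
    (Multiplicative.ofAdd ![1, 0])
  refine ⟨?_, HerbstFatou.autOrbit_rowAut _, HerbstFatou.autOrbit_Q, HerbstFatou.alg_eq_rat _,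
    HerbstFatou.alg_eq_rat HerbstFatou.Z2 ▸ horb, horb, fun h => horb (h.symm.le hext), ?_⟩
  · intro k hk
    obtain ⟨k, rfl⟩ := Nat.exists_eq_add_of_le' hk
    rw [HerbstFatou.Q_pow_succ]
    rfl
  · intro h
    let i : HerbstFatou.Z2 →*
        HerbstFatou.ZExtension HerbstFatou.Z2 (HerbstFatou.rowAut HerbstFatou.Q) :=
      SemidirectProduct.inl
    -- The general question concerns subgroups, so the orbit is moved to the copy of $\mathbb Z^2$
    -- inside the extension; `e.symm` maps it back for the contradiction.
    let e : HerbstFatou.Z2 ≃* i.range := MonoidHom.ofInjective SemidirectProduct.inl_injective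
    have := HerbstFatou.zExtension_fg (HerbstFatou.rowAut HerbstFatou.Q)
    have hH : i.range.FG := (Group.fg_iff_subgroup_fg _).1 (Group.fg_of_surjective e.surjective)
    have hK : e '' HerbstFatou.autOrbit (HerbstFatou.rowAut HerbstFatou.Q)
        (Multiplicative.ofAdd ![1, 0]) ∈ HerbstFatou.Alg i.range := by
      rw [h _ i.range hH, Set.mem_ofPred_eq, Set.image_image]
      exact hext
    refine HerbstFatou.not_isAlgebraicSubset_of_image_eq_autOrbit e.symm.toMonoidHom ?_ hK
    rw [Set.image_image]
    simp
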